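/- For density matrices $\rho,\sigma$ (positive semidefinite, unit trace) let $F(\rho,\sigma):=\|\sqrt{\rho}\sqrt{\sigma}\|_1$ be the (square root) Uhlmann fidelity, where $\|A\|_1:=\mathrm{tr}\sqrt{A^\dagger A}$. Let $\mathcal D_1,\mathcal D_2$ be finite sets of density matrices on a $d$-dimensional Hilbert space, with $|\mathcal D_i|=m_i<\infty$ for $i=1,2$, and put $F_{\max}:=\sup_{\rho_1\in\mathcal D_1,\,\rho_2\in\mathcal D_2}F(\rho_1,\rho_2)$. For $n\in\mathbb N$ let $\mathcal C_{i,n}:=\mathrm{conv}\{\rho^{\otimes n}:\rho\in\mathcal D_i\}$ be the convex hull of the $n$-fold tensor powers of the elements of $\mathcal D_i$. Then every $\sigma_{1,n}\in\mathcal C_{1,n}$ and $\sigma_{2,n}\in\mathcal C_{2,n}$ satisfy $F(\sigma_{1,n},\sigma_{2,n})\le\sqrt{m_1m_2}\,F_{\max}^n$; that is, $$\sup_{\sigma_{1,n}\in\mathcal C_{1,n},\ \sigma_{2,n}\in\mathcal C_{2,n}}F(\sigma_{1,n},\sigma_{2,n})\le\sqrt{m_1m_2}\,F_{\max}^n .$$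 -/

import Mathlib

open scoped Matrix MatrixOrder ComplexOrder

namespace QState

/-- A density matrix: positive semidefinite (in particular Hermitian) with unit trace. -/
def IsDensityMatrix {ι : Type*} [Fintype ι] (ρ : Matrix ι ι ℂ) : Prop :=
  ρ.PosSemidef ∧ ρ.trace = 1

/-- The trace norm `‖A‖₁ = tr √(A† A)`. The trace is that of a positive semidefinite matrix, hence
a nonnegative real number, and its real part is taken only to land in `ℝ`. -/
noncomputable def traceNorm {ι : Type*} [Fintype ι] [DecidableEq ι] (A : Matrix ι ι ℂ) : ℝ :=
  (CFC.sqrt (Aᴴ * A)).trace.re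

/-- The (square root) Uhlmann fidelity `F(ρ, σ) = ‖√ρ √σ‖₁`. -/
noncomputable def fidelity {ι : Type*} [Fintype ι] [DecidableEq ι] (ρ σ : Matrix ι ι ℂ) : ℝ :=
  traceNorm (CFC.sqrt ρ * CFC.sqrt σ)

/-- The `n`-fold tensor (Kronecker) power of a matrix on `ℂ^d`, acting on `(ℂ^d)^{⊗ n}`, whose
product basis is indexed by the words `Fin n → Fin d`. -/
def tensorPow {d : ℕ} (n : ℕ) (ρ : Matrix (Fin d) (Fin d) ℂ) :
    Matrix (Fin n → Fin d) (Fin n → Fin d) ℂ :=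
  Matrix.of fun a b => ∏ k, ρ (a k) (b k)

/-- The set `{ρ^{⊗ n} : ρ ∈ D}` of `n`-fold copies of the states in `D`. -/
def copies {d : ℕ} (n : ℕ) (D : Set (Matrix (Fin d) (Fin d) ℂ)) :
    Set (Matrix (Fin n → Fin d) (Fin n → Fin d) ℂ) :=
  tensorPow n '' D

/-- The convex hull of the `n`-fold copies of the states in `D`. -/
def mixtures {d : ℕ} (n : ℕ) (D : Set (Matrix (Fin d) (Fin d) ℂ)) :
    Set (Matrix (Fin n → Fin d) (Fin n → Fin d) ℂ) :=
  convexHull ℝ (copies n D)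

/-- The supremum of the fidelity over all pairs of states from two sets. -/
noncomputable def supFidelity {ι : Type*} [Fintype ι] [DecidableEq ι]
    (S T : Set (Matrix ι ι ℂ)) : ℝ :=
  sSup {x : ℝ | ∃ ρ ∈ S, ∃ σ ∈ T, x = fidelity ρ σ}

end QState

/-!
The fidelity is a trace of a square root, `F(ρ, σ) = tr √(√σ ρ √σ)`, and `tr √` is subadditive on
positive semidefinite matrices, so `F(∑ pₖ ρₖ, σ) ≤ ∑ √pₖ F(ρₖ, σ)`. By Cauchy–Schwarz the weights
contribute at most `∑ √pₖ ≤ √m` for a mixture of `m` states. Applying this in each argument and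
using that the fidelity is multiplicative on tensor powers gives the bound.

For the subadditivity put `S = √(A + B)` and let `G` be its pseudoinverse. As the square root is
operator monotone, `√A ≤ S`, whence `√A G √A ≤ √A` and `tr (G A) ≤ tr √A`; likewise for `B`. Adding
the two gives `tr S = tr (G S²) = tr (G A) + tr (G B) ≤ tr √A + tr √B`.
-/

namespace QState

section PseudoInverse

theorem mul_mul_le_self_of_le {R : Type*} [Ring R] [PartialOrder R] [StarRing R]
    [StarOrderedRing R] {a s g : R} (ha : 0 ≤ a) (has : a ≤ s) (hg : IsSelfAdjoint g)
    (hgsg : g * s * g = g) : a * g * a ≤ a := by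
  have hdecomp : a - a * g * a =
      star (1 - g * a) * a * (1 - g * a) + star (g * a) * (s - a) * (g * a) := by
    have hs : a * (g * (s * (g * a))) = a * (g * a) := by
      rw [← mul_assoc s, ← mul_assoc g, ← mul_assoc g, hgsg]
    simp only [star_sub, star_one, star_mul, hg.star_eq, (IsSelfAdjoint.of_nonneg ha).star_eq,
      mul_sub, sub_mul, one_mul, mul_one, mul_assoc, hs]
    abel
  rw [← sub_nonneg, hdecomp]
  exact add_nonneg (star_left_conjugate_nonneg ha _)
    (star_left_conjugate_nonneg (sub_nonneg.mpr has) _)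

theorem exists_isSelfAdjoint_pseudoinverse {ι 𝕜 : Type*} [RCLike 𝕜] [Fintype ι]
    {S : Matrix ι ι 𝕜} (hS : IsSelfAdjoint S) :
    ∃ G : Matrix ι ι 𝕜, IsSelfAdjoint G ∧ G * S * G = G ∧ S * G * S = S := by
  classical
  have hinv : ContinuousOn (fun x : ℝ => x⁻¹) (spectrum ℝ S) :=
    S.finite_real_spectrum.continuousOn _
  have hinv_mul (x : ℝ) : x⁻¹ * x * x⁻¹ = x⁻¹ := by
    simpa only [inv_inv] using mul_inv_mul_cancel x⁻¹
  have hid : cfc (fun x : ℝ => x) S = S := cfc_id' ℝ S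
  -- As `0⁻¹ = 0`, the spectral function `x⁻¹` vanishes on the kernel of `S`.
  refine ⟨cfc (fun x : ℝ => x⁻¹) S, cfc_predicate _ S, ?_, ?_⟩
  · calc cfc (fun x : ℝ => x⁻¹) S * S * cfc (fun x : ℝ => x⁻¹) S
        = cfc (fun x : ℝ => x⁻¹ * x * x⁻¹) S := by rw [cfc_mul .., cfc_mul .., hid]
      _ = cfc (fun x : ℝ => x⁻¹) S := by simp only [hinv_mul]
  · calc S * cfc (fun x : ℝ => x⁻¹) S * S
        = cfc (fun x : ℝ => x * x⁻¹ * x) S := by rw [cfc_mul .., cfc_mul .., hid]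
      _ = S := by simp only [mul_inv_mul_cancel, hid]

end PseudoInverse

section TraceSqrt

variable {ι 𝕜 : Type*} [RCLike 𝕜] [Fintype ι]

theorem trace_mono {A B : Matrix ι ι 𝕜} (h : A ≤ B) : A.trace ≤ B.trace :=
  OrderHomClass.mono (Matrix.tracePositiveLinearMap ι ℝ 𝕜) h

variable [DecidableEq ι]

theorem isHermitian_sqrt (A : Matrix ι ι 𝕜) : (CFC.sqrt A).IsHermitian :=
  IsSelfAdjoint.of_nonneg (CFC.sqrt_nonneg A)

theorem trace_sqrt_nonneg (A : Matrix ι ι 𝕜) : 0 ≤ (CFC.sqrt A).trace :=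
  (Matrix.nonneg_iff_posSemidef.mp (CFC.sqrt_nonneg A)).trace_nonneg

theorem trace_mul_le_trace_sqrt {A S G : Matrix ι ι 𝕜} (hA : 0 ≤ A) (hAS : CFC.sqrt A ≤ S)
    (hG : IsSelfAdjoint G) (hGSG : G * S * G = G) : (G * A).trace ≤ (CFC.sqrt A).trace :=
  calc (G * A).trace = (CFC.sqrt A * G * CFC.sqrt A).trace := by
        rw [Matrix.trace_mul_cycle, CFC.sqrt_mul_sqrt_self A, Matrix.trace_mul_comm]
    _ ≤ (CFC.sqrt A).trace := trace_mono (mul_mul_le_self_of_le (CFC.sqrt_nonneg A) hAS hG hGSG)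

open scoped Matrix.Norms.L2Operator in
theorem sqrt_mono {A B : Matrix ι ι ℂ} (h : A ≤ B) : CFC.sqrt A ≤ CFC.sqrt B :=
  CFC.sqrt_le_sqrt A B h

theorem trace_sqrt_add_le {A B : Matrix ι ι ℂ} (hA : 0 ≤ A) (hB : 0 ≤ B) :
    (CFC.sqrt (A + B)).trace ≤ (CFC.sqrt A).trace + (CFC.sqrt B).trace := by
  obtain ⟨G, hG, hGSG, hSGS⟩ :=
    exists_isSelfAdjoint_pseudoinverse (isHermitian_sqrt (A + B)).isSelfAdjoint
  calc (CFC.sqrt (A + B)).trace = (CFC.sqrt (A + B) * G * CFC.sqrt (A + B)).trace := by rw [hSGS]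
    _ = (G * (A + B)).trace := by
        rw [Matrix.trace_mul_cycle, CFC.sqrt_mul_sqrt_self (A + B) (add_nonneg hA hB),
          Matrix.trace_mul_comm]
    _ = (G * A).trace + (G * B).trace := by rw [Matrix.mul_add, Matrix.trace_add]
    _ ≤ (CFC.sqrt A).trace + (CFC.sqrt B).trace := add_le_add
        (trace_mul_le_trace_sqrt hA (sqrt_mono (le_add_of_nonneg_right hB)) hG hGSG)
        (trace_mul_le_trace_sqrt hB (sqrt_mono (le_add_of_nonneg_left hA)) hG hGSG)

theorem trace_sqrt_sum_le {κ : Type*} (s : Finset κ) (A : κ → Matrix ι ι ℂ)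
    (hA : ∀ k ∈ s, 0 ≤ A k) :
    (CFC.sqrt (∑ k ∈ s, A k)).trace ≤ ∑ k ∈ s, (CFC.sqrt (A k)).trace :=
  Finset.le_sum_of_subadditive_on_pred (fun M : Matrix ι ι ℂ => (CFC.sqrt M).trace) (0 ≤ ·)
    (by simp) (fun _ _ => trace_sqrt_add_le)
    (fun _ _ => add_nonneg) A hA

theorem sqrt_smul {A : Matrix ι ι 𝕜} (hA : 0 ≤ A) {p : ℝ} (hp : 0 ≤ p) :
    CFC.sqrt (p • A) = √p • CFC.sqrt A := by
  refine CFC.sqrt_unique ?_ (smul_nonneg (Real.sqrt_nonneg p) (CFC.sqrt_nonneg A))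
  rw [smul_mul_smul_comm, Real.mul_self_sqrt hp, CFC.sqrt_mul_sqrt_self A]

theorem trace_cfc_eq_of_charpoly_eq {A B : Matrix ι ι 𝕜} (hA : A.IsHermitian)
    (hB : B.IsHermitian) (h : A.charpoly = B.charpoly) (f : ℝ → ℝ) :
    (cfc f A).trace = (cfc f B).trace := by
  rw [Matrix.trace_eq_neg_charpoly_nextCoeff, Matrix.trace_eq_neg_charpoly_nextCoeff,
    hA.charpoly_cfc_eq, hB.charpoly_cfc_eq,
    (Matrix.IsHermitian.eigenvalues_eq_eigenvalues_iff hA hB).mpr h]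

theorem trace_sqrt_self_mul_conjTranspose (A : Matrix ι ι 𝕜) :
    (CFC.sqrt (A * Aᴴ)).trace = (CFC.sqrt (Aᴴ * A)).trace := by
  have hl := Matrix.posSemidef_self_mul_conjTranspose A
  have hr := Matrix.posSemidef_conjTranspose_mul_self A
  rw [CFC.sqrt_eq_real_sqrt _ hl.nonneg, CFC.sqrt_eq_real_sqrt _ hr.nonneg, cfcₙ_eq_cfc,
    cfcₙ_eq_cfc]
  exact trace_cfc_eq_of_charpoly_eq hl.isHermitian hr.isHermitian (Matrix.charpoly_mul_comm _ _) _

end TraceSqrt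

section Fidelity

variable {ι : Type*} [Fintype ι] [DecidableEq ι]

theorem traceNorm_nonneg (A : Matrix ι ι ℂ) : 0 ≤ traceNorm A :=
  (Complex.nonneg_iff.mp (trace_sqrt_nonneg _)).1

theorem ofReal_traceNorm (A : Matrix ι ι ℂ) : (traceNorm A : ℂ) = (CFC.sqrt (Aᴴ * A)).trace :=
  Complex.ext rfl (Complex.nonneg_iff.mp (trace_sqrt_nonneg _)).2

theorem traceNorm_conjTranspose (A : Matrix ι ι ℂ) : traceNorm Aᴴ = traceNorm A := by
  rw [traceNorm, traceNorm, Matrix.conjTranspose_conjTranspose, trace_sqrt_self_mul_conjTranspose]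

theorem traceNorm_smul (r : ℝ) (A : Matrix ι ι ℂ) : traceNorm (r • A) = |r| * traceNorm A := by
  have hA : 0 ≤ Aᴴ * A := (Matrix.posSemidef_conjTranspose_mul_self A).nonneg
  rw [traceNorm, Matrix.conjTranspose_smul, star_trivial, smul_mul_smul_comm,
    sqrt_smul hA (mul_self_nonneg r), Real.sqrt_mul_self_eq_abs, Matrix.trace_smul, Complex.smul_re,
    smul_eq_mul, traceNorm]

theorem fidelity_nonneg (ρ σ : Matrix ι ι ℂ) : 0 ≤ fidelity ρ σ :=
  traceNorm_nonneg _

theorem fidelity_comm (ρ σ : Matrix ι ι ℂ) : fidelity ρ σ = fidelity σ ρ := by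
  rw [fidelity, ← traceNorm_conjTranspose, Matrix.conjTranspose_mul, (isHermitian_sqrt ρ).eq,
    (isHermitian_sqrt σ).eq, fidelity]

theorem ofReal_fidelity {ρ : Matrix ι ι ℂ} (hρ : 0 ≤ ρ) (σ : Matrix ι ι ℂ) :
    (fidelity ρ σ : ℂ) = (CFC.sqrt (CFC.sqrt σ * ρ * CFC.sqrt σ)).trace := by
  rw [fidelity, ofReal_traceNorm, Matrix.conjTranspose_mul, (isHermitian_sqrt ρ).eq,
    (isHermitian_sqrt σ).eq, Matrix.mul_assoc, ← Matrix.mul_assoc (CFC.sqrt ρ),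
    CFC.sqrt_mul_sqrt_self ρ, Matrix.mul_assoc]

theorem fidelity_smul_left {ρ : Matrix ι ι ℂ} (hρ : 0 ≤ ρ) {p : ℝ} (hp : 0 ≤ p)
    (σ : Matrix ι ι ℂ) : fidelity (p • ρ) σ = √p * fidelity ρ σ := by
  rw [fidelity, sqrt_smul hρ hp, Matrix.smul_mul, traceNorm_smul,
    abs_of_nonneg (Real.sqrt_nonneg p), fidelity]

theorem fidelity_sum_left_le {κ : Type*} (s : Finset κ) (ρ : κ → Matrix ι ι ℂ)
    (hρ : ∀ k ∈ s, 0 ≤ ρ k) (σ : Matrix ι ι ℂ) :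
    fidelity (∑ k ∈ s, ρ k) σ ≤ ∑ k ∈ s, fidelity (ρ k) σ := by
  have hconj : ∀ k ∈ s, 0 ≤ CFC.sqrt σ * ρ k * CFC.sqrt σ := fun k hk =>
    conjugate_nonneg_of_nonneg (hρ k hk) (CFC.sqrt_nonneg σ)
  rw [← Complex.real_le_real, Complex.ofReal_sum, ofReal_fidelity (Finset.sum_nonneg hρ),
    Finset.sum_congr rfl fun k hk => ofReal_fidelity (hρ k hk) σ, Matrix.mul_sum, Matrix.sum_mul]
  exact trace_sqrt_sum_le s _ hconj

end Fidelity

section Mixtures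

variable {ι : Type*} [Fintype ι] [DecidableEq ι]

theorem sum_sqrt_le_sqrt_card_mul_sum {κ : Type*} (s : Finset κ) (p : κ → ℝ)
    (hp : ∀ k ∈ s, 0 ≤ p k) : ∑ k ∈ s, √(p k) ≤ √(s.card * ∑ k ∈ s, p k) := by
  refine Real.le_sqrt_of_sq_le (sq_sum_le_card_mul_sum_sq.trans_eq ?_)
  rw [Finset.sum_congr rfl fun k hk => Real.sq_sqrt (hp k hk)]

theorem fidelity_le_of_mem_convexHull_left {S : Set (Matrix ι ι ℂ)} (hfin : S.Finite)
    (hS : ∀ ρ ∈ S, 0 ≤ ρ) {σ : Matrix ι ι ℂ} {c : ℝ} (hc : ∀ ρ ∈ S, fidelity ρ σ ≤ c)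
    {τ : Matrix ι ι ℂ} (hτ : τ ∈ convexHull ℝ S) : fidelity τ σ ≤ √S.ncard * c := by
  obtain ⟨ρ₀, hρ₀⟩ := convexHull_nonempty_iff.mp ⟨τ, hτ⟩
  have hc₀ : 0 ≤ c := (fidelity_nonneg ρ₀ σ).trans (hc ρ₀ hρ₀)
  lift S to Finset (Matrix ι ι ℂ) using hfin
  obtain ⟨p, hp, hsum, rfl⟩ := Finset.mem_convexHull'.mp hτ
  calc fidelity (∑ ρ ∈ S, p ρ • ρ) σ ≤ ∑ ρ ∈ S, fidelity (p ρ • ρ) σ :=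
        fidelity_sum_left_le S _ (fun ρ hρ => smul_nonneg (hp ρ hρ) (hS ρ hρ)) σ
    _ = ∑ ρ ∈ S, √(p ρ) * fidelity ρ σ :=
        Finset.sum_congr rfl fun ρ hρ => fidelity_smul_left (hS ρ hρ) (hp ρ hρ) σ
    _ ≤ ∑ ρ ∈ S, √(p ρ) * c := by gcongr with ρ hρ; exact hc ρ hρ
    _ = (∑ ρ ∈ S, √(p ρ)) * c := (Finset.sum_mul ..).symm
    _ ≤ √(S : Set (Matrix ι ι ℂ)).ncard * c := by
        rw [Set.ncard_coe_finset, ← mul_one (S.card : ℝ), ← hsum]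
        gcongr
        exact sum_sqrt_le_sqrt_card_mul_sum S p hp

theorem fidelity_le_of_mem_convexHull {S T : Set (Matrix ι ι ℂ)} (hSfin : S.Finite)
    (hTfin : T.Finite) (hS : ∀ ρ ∈ S, 0 ≤ ρ) (hT : ∀ σ ∈ T, 0 ≤ σ) {c : ℝ}
    (hc : ∀ ρ ∈ S, ∀ σ ∈ T, fidelity ρ σ ≤ c) {τ₁ τ₂ : Matrix ι ι ℂ}
    (h₁ : τ₁ ∈ convexHull ℝ S) (h₂ : τ₂ ∈ convexHull ℝ T) :
    fidelity τ₁ τ₂ ≤ √(S.ncard * T.ncard) * c := by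
  rw [Real.sqrt_mul (Nat.cast_nonneg _), mul_assoc]
  refine fidelity_le_of_mem_convexHull_left hSfin hS (fun ρ hρ => ?_) h₁
  rw [fidelity_comm]
  refine fidelity_le_of_mem_convexHull_left hTfin hT (fun σ hσ => ?_) h₂
  rw [fidelity_comm]
  exact hc ρ hρ σ hσ

theorem fidelity_le_supFidelity {S T : Set (Matrix ι ι ℂ)} (hS : S.Finite) (hT : T.Finite)
    {ρ σ : Matrix ι ι ℂ} (hρ : ρ ∈ S) (hσ : σ ∈ T) : fidelity ρ σ ≤ supFidelity S T := by
  refine le_csSup ((hS.image2 fidelity hT).subset ?_).bddAbove ⟨ρ, hρ, σ, hσ, rfl⟩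
  rintro x ⟨ρ', hρ', σ', hσ', rfl⟩
  exact Set.mem_image2_of_mem hρ' hσ'

theorem supFidelity_nonneg (S T : Set (Matrix ι ι ℂ)) : 0 ≤ supFidelity S T := by
  refine Real.sSup_nonneg ?_
  rintro x ⟨ρ, -, σ, -, rfl⟩
  exact fidelity_nonneg ρ σ

theorem supFidelity_le {S T : Set (Matrix ι ι ℂ)} {c : ℝ} (hc₀ : 0 ≤ c)
    (hc : ∀ ρ ∈ S, ∀ σ ∈ T, fidelity ρ σ ≤ c) : supFidelity S T ≤ c := by
  refine Real.sSup_le ?_ hc₀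
  rintro x ⟨ρ, hρ, σ, hσ, rfl⟩
  exact hc ρ hρ σ hσ

end Mixtures

section TensorPow

variable {d : ℕ} (n : ℕ)

theorem tensorPow_mul (A B : Matrix (Fin d) (Fin d) ℂ) :
    tensorPow n (A * B) = tensorPow n A * tensorPow n B := by
  ext a b
  simp only [tensorPow, Matrix.of_apply, Matrix.mul_apply, ← Finset.prod_mul_distrib]
  rw [Finset.prod_univ_sum, Fintype.piFinset_univ]

theorem conjTranspose_tensorPow (A : Matrix (Fin d) (Fin d) ℂ) :
    (tensorPow n A)ᴴ = tensorPow n Aᴴ := by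
  ext a b
  simp only [tensorPow, Matrix.conjTranspose_apply, Matrix.of_apply, star_prod]

theorem trace_tensorPow (A : Matrix (Fin d) (Fin d) ℂ) :
    (tensorPow n A).trace = A.trace ^ n := by
  simp only [Matrix.trace, Matrix.diag_apply, tensorPow, Matrix.of_apply]
  rw [Finset.sum_pow', Fintype.piFinset_univ]

theorem tensorPow_nonneg {A : Matrix (Fin d) (Fin d) ℂ} (hA : 0 ≤ A) : 0 ≤ tensorPow n A := by
  rw [← CFC.sqrt_mul_sqrt_self A, tensorPow_mul]
  nth_rw 1 [← (isHermitian_sqrt A).eq]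
  rw [← conjTranspose_tensorPow]
  exact (Matrix.posSemidef_conjTranspose_mul_self _).nonneg

theorem sqrt_tensorPow {A : Matrix (Fin d) (Fin d) ℂ} (hA : 0 ≤ A) :
    CFC.sqrt (tensorPow n A) = tensorPow n (CFC.sqrt A) := by
  refine CFC.sqrt_unique ?_ (tensorPow_nonneg n (CFC.sqrt_nonneg A))
  rw [← tensorPow_mul, CFC.sqrt_mul_sqrt_self A]

theorem traceNorm_tensorPow (A : Matrix (Fin d) (Fin d) ℂ) :
    traceNorm (tensorPow n A) = traceNorm A ^ n := by
  apply Complex.ofReal_injective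
  rw [Complex.ofReal_pow, ofReal_traceNorm, ofReal_traceNorm, conjTranspose_tensorPow,
    ← tensorPow_mul, sqrt_tensorPow n (Matrix.posSemidef_conjTranspose_mul_self A).nonneg,
    trace_tensorPow]

theorem fidelity_tensorPow {ρ σ : Matrix (Fin d) (Fin d) ℂ} (hρ : 0 ≤ ρ) (hσ : 0 ≤ σ) :
    fidelity (tensorPow n ρ) (tensorPow n σ) = fidelity ρ σ ^ n := by
  rw [fidelity, sqrt_tensorPow n hρ, sqrt_tensorPow n hσ, ← tensorPow_mul, traceNorm_tensorPow,
    fidelity]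

variable {n} {D₁ D₂ : Set (Matrix (Fin d) (Fin d) ℂ)}

theorem fidelity_le_of_mem_copies (hfin₁ : D₁.Finite) (hfin₂ : D₂.Finite)
    (hD₁ : ∀ ρ ∈ D₁, 0 ≤ ρ) (hD₂ : ∀ ρ ∈ D₂, 0 ≤ ρ)
    {τ₁ τ₂ : Matrix (Fin n → Fin d) (Fin n → Fin d) ℂ}
    (h₁ : τ₁ ∈ copies n D₁) (h₂ : τ₂ ∈ copies n D₂) :
    fidelity τ₁ τ₂ ≤ supFidelity D₁ D₂ ^ n := by
  obtain ⟨ρ, hρ, rfl⟩ := h₁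
  obtain ⟨σ, hσ, rfl⟩ := h₂
  rw [fidelity_tensorPow n (hD₁ ρ hρ) (hD₂ σ hσ)]
  exact pow_le_pow_left₀ (fidelity_nonneg ρ σ) (fidelity_le_supFidelity hfin₁ hfin₂ hρ hσ) n

theorem fidelity_le_of_mem_mixtures (hfin₁ : D₁.Finite) (hfin₂ : D₂.Finite)
    (hD₁ : ∀ ρ ∈ D₁, 0 ≤ ρ) (hD₂ : ∀ ρ ∈ D₂, 0 ≤ ρ)
    {σ₁ σ₂ : Matrix (Fin n → Fin d) (Fin n → Fin d) ℂ}
    (h₁ : σ₁ ∈ mixtures n D₁) (h₂ : σ₂ ∈ mixtures n D₂) :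
    fidelity σ₁ σ₂ ≤ √(D₁.ncard * D₂.ncard) * supFidelity D₁ D₂ ^ n := by
  have hF := pow_nonneg (supFidelity_nonneg D₁ D₂) n
  calc fidelity σ₁ σ₂
      ≤ √((copies n D₁).ncard * (copies n D₂).ncard) * supFidelity D₁ D₂ ^ n :=
        fidelity_le_of_mem_convexHull (hfin₁.image _) (hfin₂.image _)
          (Set.forall_mem_image.mpr fun ρ hρ => tensorPow_nonneg n (hD₁ ρ hρ))
          (Set.forall_mem_image.mpr fun ρ hρ => tensorPow_nonneg n (hD₂ ρ hρ))
          (fun _ h _ h' => fidelity_le_of_mem_copies hfin₁ hfin₂ hD₁ hD₂ h h') h₁ h₂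
    _ ≤ √(D₁.ncard * D₂.ncard) * supFidelity D₁ D₂ ^ n := by
        gcongr
        · exact Set.ncard_image_le hfin₁
        · exact Set.ncard_image_le hfin₂

end TensorPow

end QState

theorem mainTheorem8_general (d n m₁ m₂ : ℕ) (D₁ D₂ : Set (Matrix (Fin d) (Fin d) ℂ))
    (hD₁ : ∀ ρ ∈ D₁, ρ.PosSemidef) (hD₂ : ∀ ρ ∈ D₂, ρ.PosSemidef)
    (hm₁ : D₁.encard = m₁) (hm₂ : D₂.encard = m₂) :
    (∀ σ₁ ∈ QState.mixtures n D₁, ∀ σ₂ ∈ QState.mixtures n D₂,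
      QState.fidelity σ₁ σ₂ ≤ √((m₁ : ℝ) * (m₂ : ℝ)) * QState.supFidelity D₁ D₂ ^ n) ∧
    QState.supFidelity (QState.mixtures n D₁) (QState.mixtures n D₂) ≤
      √((m₁ : ℝ) * (m₂ : ℝ)) * QState.supFidelity D₁ D₂ ^ n := by
  have hbound : ∀ σ₁ ∈ QState.mixtures n D₁, ∀ σ₂ ∈ QState.mixtures n D₂,
      QState.fidelity σ₁ σ₂ ≤ √((m₁ : ℝ) * (m₂ : ℝ)) * QState.supFidelity D₁ D₂ ^ n := by
    intro σ₁ h₁ σ₂ h₂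
    simpa only [Set.ncard, hm₁, hm₂, ENat.toNat_natCast] using QState.fidelity_le_of_mem_mixtures
      (Set.finite_of_encard_eq_coe hm₁) (Set.finite_of_encard_eq_coe hm₂)
      (fun ρ hρ => (hD₁ ρ hρ).nonneg) (fun ρ hρ => (hD₂ ρ hρ).nonneg) h₁ h₂
  have hF := pow_nonneg (QState.supFidelity_nonneg D₁ D₂) n
  exact ⟨hbound, QState.supFidelity_le (by positivity) hbound⟩

theorem mainTheorem8 (d n m₁ m₂ : ℕ) (D₁ D₂ : Set (Matrix (Fin d) (Fin d) ℂ))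
    (hD₁ : ∀ ρ ∈ D₁, QState.IsDensityMatrix ρ) (hD₂ : ∀ ρ ∈ D₂, QState.IsDensityMatrix ρ)
    (hm₁ : D₁.encard = m₁) (hm₂ : D₂.encard = m₂) :
    (∀ σ₁ ∈ QState.mixtures n D₁, ∀ σ₂ ∈ QState.mixtures n D₂,
      QState.fidelity σ₁ σ₂ ≤ √((m₁ : ℝ) * (m₂ : ℝ)) * QState.supFidelity D₁ D₂ ^ n) ∧
    QState.supFidelity (QState.mixtures n D₁) (QState.mixtures n D₂) ≤
      √((m₁ : ℝ) * (m₂ : ℝ)) * QState.supFidelity D₁ D₂ ^ n :=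
  mainTheorem8_general d n m₁ m₂ D₁ D₂ (fun ρ hρ => (hD₁ ρ hρ).1) (fun ρ hρ => (hD₂ ρ hρ).1) hm₁ hm₂
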